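/- Let $\mathbf C$ be a finitely complete category and $\pi\colon\widetilde{\mathcal U}\to\mathcal U$ a universal map, i.e. an exponentiable map (with pushforward $\pi_*$) together with a choice of pullbacks along it. A $\pi$-fibrancy structure on a map $E\to B$ is a pullback square exhibiting it as a pullback of $\pi$ along some $\ulcorner E\urcorner\colon B\to\mathcal U$. Suppose $\pi$ is equipped with a pre-$\mathrm{Id}$-type structure, i.e. a commutative square $(\mathrm{Id},\ulcorner\mathrm{refl}\urcorner)$ from the diagonal $\widetilde{\mathcal U}\to\widetilde{\mathcal U}\times_{\mathcal U}\widetilde{\mathcal U}$ to $\pi$. For $E\to B$ with a fibrancy structure, let $\partial\colon\mathrm{Id}_B(E)\to E\times_B E$ be the chosen pullback of $\pi$ along $E\times_BE\to\widetilde{\mathcal U}\times_{\mathcal U}\widetilde{\mathcal U}\xrightarrow{\mathrm{Id}}\mathcal U$, let $\mathrm{ev}_0,\mathrm{ev}_1\colon\mathrm{Id}_B(E)\to E$ be its two components, and let $\mathrm{refl}_E\colon E\to\mathrm{Id}_B(E)$ be the induced lift of the diagonal. Write $\mathrm{refl}\colon\widetilde{\mathcal U}\to\mathrm{Id}_{\mathcal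 U}(\widetilde{\mathcal U})$ for the case $E\to B$ equal to $\pi$. An $\mathrm{Id}$-homotopy from $a$ to $b$, for $a,b\colon X\rightrightarrows E$ over $B$, is a map $H\colon X\to\mathrm{Id}_B(E)$ with $\partial H=(a,b)$; it is constant along $i\colon W\to X$ if $ai=bi$ and $Hi=\mathrm{refl}_E\cdot ai$. For maps $i\colon K\to L$ and $p\colon P\to Q$ in the slice $\mathbf C/B$, a lower-half lifting structure of $i$ against $p$ assigns to each $X\in\mathbf C/B$ and each pair $u\colon X\times_BK\to P$, $v\colon X\times_BL\to Q$ over $B$ with $pu=v(X\times_Bi)$ a map $F_X(u,v)\colon X\times_BL\to P$ over $B$ with $p\,F_X(u,v)=v$, such that $F_Y(u(t\times_BK),v(t\times_BL))=F_X(u,v)(t\times_BL)$ for all $t\colon Y\to X$. A full lifting structure moreover satisfies $F_X(u,v)(X\times_Bi)=u$. The auxiliary structures used below are as follows. \begin{itemize} \item A transport structure is a map $\mathrm{ev}_0^*X\to\mathrm{ev}_1^*X$ over $\mathrm{Id}_B(E)$, for $X\to E\to B$ the generic composable pair $\mathrm{ev}^*(\widetilde{\mathcal U}\times\widetilde{\mathcal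 U})\to\pi^*\pi_*(\widetilde{\mathcal U}\times\mathcal U)\to\pi_*(\widetilde{\mathcal U}\times\mathcal U)$. Here the second map carries its canonical fibrancy structure, and the first is the pullback of $\widetilde{\mathcal U}\times\pi$ along the counit $\mathrm{ev}\colon\pi^*\pi_*(\widetilde{\mathcal U}\times\mathcal U)\to\widetilde{\mathcal U}\times\mathcal U$. \item The pre-$\mathrm{Id}$-type structure is a (full) $\mathrm{Id}$-type structure if it is equipped with a $\mathsf J$-elimination structure, i.e. a full lifting structure in $\mathbf C/\mathcal U$ of $\mathrm{refl}\colon\widetilde{\mathcal U}\to\mathrm{Id}_{\mathcal U}(\widetilde{\mathcal U})$ against $\mathcal U\times\pi\colon\mathcal U\times\widetilde{\mathcal U}\to\mathcal U\times\mathcal U$. \item A $\Pi$-type structure is a $\pi$-fibrancy structure on $\pi_*(\widetilde{\mathcal U}\times\pi)\colon\pi_*(\widetilde{\mathcal U}\times\widetilde{\mathcal U})\to\pi_*(\widetilde{\mathcal U}\times\mathcal U)$. \end{itemize} \textbf{Proposition.} Let $B\in\mathbf C$, let $f\colon E\to Y$ be a map in $\mathbf C/B$ where $E\to B$ is equipped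 with a $\pi$-fibrancy structure, and let $g\colon Y\to E$ be a section of $f$ in $\mathbf C/B$ (so $fg=\mathrm{id}_Y$). \begin{enumerate} \item Suppose the pre-$\mathrm{Id}$-type structure has a transport structure. Then $g$ is an $\mathrm{Id}$-homotopy retraction of $f$ (i.e. there is an $\mathrm{Id}$-homotopy over $B$ from $gf$ to $\mathrm{id}_E$) if and only if $g$ has a lower-half lifting structure in $\mathbf C/B$ against $B\times\pi\colon B\times\widetilde{\mathcal U}\to B\times\mathcal U$. \item Suppose the pre-$\mathrm{Id}$-type structure is a full $\mathrm{Id}$-type structure and $\pi$ has a $\Pi$-type structure. Then $g$ exhibits $f$ as the dual of a strong $\mathrm{Id}$-deformation retract (i.e. there is an $\mathrm{Id}$-homotopy over $B$ from $gf$ to $\mathrm{id}_E$ that is constant along $g$) if and only if $g$ has a full lifting structure in $\mathbf C/B$ against $B\times\pi$. \end{enumerate} -/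

import Mathlib

open CategoryTheory Limits MonoidalCategory

universe v u

namespace UniverseCategory

noncomputable section

/-! ## Lifting structures -/

section Lifting

variable {D : Type u} [Category.{v} D] [CartesianMonoidalCategory D]

/-- A uniform family of lower-half lifts of `i : K ⟶ L` against `p : E ⟶ B`: every commutative
square from `X × i` to `p` gets a diagonal making the *lower* triangle commute, naturally in the
object `X`. Nothing is asked of the upper triangle. -/
structure LowerHalfLiftingStructure {K L E B : D} (i : K ⟶ L) (p : E ⟶ B) where
  lift : ∀ (X : D) (a : X ⊗ K ⟶ E) (b : X ⊗ L ⟶ B), a ≫ p = X ◁ i ≫ b → (X ⊗ L ⟶ E)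
  lift_comp : ∀ (X : D) (a : X ⊗ K ⟶ E) (b : X ⊗ L ⟶ B) (h : a ≫ p = X ◁ i ≫ b),
    lift X a b h ≫ p = b
  uniform : ∀ (X Y : D) (t : Y ⟶ X) (a : X ⊗ K ⟶ E) (b : X ⊗ L ⟶ B)
    (h : a ≫ p = X ◁ i ≫ b) (h' : (t ▷ K ≫ a) ≫ p = Y ◁ i ≫ t ▷ L ≫ b),
    lift Y (t ▷ K ≫ a) (t ▷ L ≫ b) h' = t ▷ L ≫ lift X a b h

/-- A uniform family of full lifts of `i : K ⟶ L` against `p : E ⟶ B`: both triangles commute. -/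
structure LiftingStructure {K L E B : D} (i : K ⟶ L) (p : E ⟶ B) extends
    LowerHalfLiftingStructure i p where
  comp_lift : ∀ (X : D) (a : X ⊗ K ⟶ E) (b : X ⊗ L ⟶ B) (h : a ≫ p = X ◁ i ≫ b),
    X ◁ i ≫ lift X a b h = a

end Lifting

/-- Products in a slice category are given by pullbacks. -/
local instance overCartesian {C : Type u} [Category.{v} C] [HasPullbacks C] (B : C) :
    CartesianMonoidalCategory (Over B) :=
  Over.cartesianMonoidalCategory B

variable {C : Type u} [Category.{v} C] [HasFiniteLimits C]

/-- Uniform lower-half lifts, in the slice over `B`, of `i` against `B × π : B × T ⟶ B × U`. -/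
abbrev SliceLowerHalfLiftingStructure {T U : C} (π : T ⟶ U) {B : C} {K L : Over B} (i : K ⟶ L) :=
  LowerHalfLiftingStructure i ((Over.star B).map π)

/-- Uniform full lifts, in the slice over `B`, of `i` against `B × π : B × T ⟶ B × U`. -/
abbrev SliceLiftingStructure {T U : C} (π : T ⟶ U) {B : C} {K L : Over B} (i : K ⟶ L) :=
  LiftingStructure i ((Over.star B).map π)

/-! ## Universal maps

A universal map is an exponentiable map `π : T ⟶ U` (`ExponentiableMorphism π`) with a choice of
pullbacks along it (`ChosenPullbacksAlong π`). -/

/-- A `π`-fibrancy structure on `p : E ⟶ B`: a `π`-name and a `π`-point exhibiting `p` as a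
pullback of `π`. -/
structure FibrancyStructure {T U : C} (π : T ⟶ U) {E B : C} (p : E ⟶ B) where
  name : B ⟶ U
  point : E ⟶ T
  isPullback : IsPullback point p π name

/-- The canonical `π`-fibrancy structure on the selected pullback of `π` along `A`. -/
def FibrancyStructure.canonical {T U : C} (π : T ⟶ U) [ChosenPullbacksAlong π] {Γ : C}
    (A : Γ ⟶ U) : FibrancyStructure π (ChosenPullbacksAlong.fst A π) where
  name := A
  point := ChosenPullbacksAlong.snd A π
  isPullback := (ChosenPullbacksAlong.isPullback A π).flip

/-- The polynomial functor `X ↦ π_* (T × X)` of a universal map `π : T ⟶ U`. -/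
def polynomialFunctor {T U : C} (π : T ⟶ U) [ChosenPullbacksAlong π] [ExponentiableMorphism π] :
    C ⥤ C :=
  Over.star T ⋙ ExponentiableMorphism.pushforward π ⋙ Over.forget U

/-- A `Π`-type structure: a `π`-fibrancy structure on the polynomial functor of `π` applied
to `π`. -/
abbrev PiTypeStructure {T U : C} (π : T ⟶ U) [ChosenPullbacksAlong π] [ExponentiableMorphism π] :=
  FibrancyStructure π ((polynomialFunctor π).map π)

/-! ## Identity types -/

/-- A pre-`Id`-type structure: a commutative square from the diagonal of `π` to `π`. -/
structure PreIdTypeStructure {T U : C} (π : T ⟶ U) where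
  Id : pullback π π ⟶ U
  reflName : T ⟶ T
  comm : reflName ≫ π = pullback.diagonal π ≫ Id

section Id

variable {T U : C} {π : T ⟶ U} [ChosenPullbacksAlong π] (I : PreIdTypeStructure π)

namespace PreIdTypeStructure

/-- The object `Id_U(T)`, the selected pullback of `π` along `Id`. -/
abbrev univIdObj : C := ChosenPullbacksAlong.pullbackObj I.Id π

/-- The endpoint map `Id_U(T) ⟶ T ×_U T`. -/
abbrev univEndpoints : I.univIdObj ⟶ pullback π π := ChosenPullbacksAlong.fst I.Id π

/-- The map `refl : T ⟶ Id_U(T)`. -/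
def univRefl : T ⟶ I.univIdObj :=
  ChosenPullbacksAlong.lift (pullback.diagonal π) I.reflName I.comm.symm

/-- The map `refl : T ⟶ Id_U(T)` in the slice over `U`. -/
def univReflOver :
    Over.mk π ⟶ Over.mk (I.univEndpoints ≫ pullback.fst π π ≫ π) :=
  Over.homMk I.univRefl (by simp [univRefl])

/-- A `J`-elimination structure: uniform lifts, in the slice over `U`, of `refl : T ⟶ Id_U(T)`
against `U × π : U × T ⟶ U × U`; by the Yoneda lemma, the same thing as a section of the
pullback-Hom map of `refl` and `U × π` over `U`. -/
abbrev JElimStructure := SliceLiftingStructure π I.univReflOver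

variable {E B : C} {p : E ⟶ B} (F : FibrancyStructure π p)

/-- The name `E ×_B E ⟶ T ×_U T ⟶ U` of the identity type of a `π`-fibration `E ⟶ B`. -/
def idName : pullback p p ⟶ U :=
  pullback.map p p π π F.point F.point F.name F.isPullback.w.symm F.isPullback.w.symm ≫ I.Id

/-- The object `Id_B(E)`, the selected pullback of `π` along `E ×_B E ⟶ U`. -/
abbrev idObj : C := ChosenPullbacksAlong.pullbackObj (I.idName F) π

/-- The endpoint map `Id_B(E) ⟶ E ×_B E`. -/
abbrev endpoints : I.idObj F ⟶ pullback p p := ChosenPullbacksAlong.fst (I.idName F) π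

abbrev ev₀ : I.idObj F ⟶ E := I.endpoints F ≫ pullback.fst p p

abbrev ev₁ : I.idObj F ⟶ E := I.endpoints F ≫ pullback.snd p p

theorem diagonal_idName : pullback.diagonal p ≫ I.idName F = (F.point ≫ I.reflName) ≫ π := by
  rw [Category.assoc, I.comm, idName, ← Category.assoc, ← Category.assoc]
  congr 1
  apply pullback.hom_ext
  · rw [Category.assoc, pullback.map, pullback.lift_fst]
    simp
  · rw [Category.assoc, pullback.map, pullback.lift_snd]
    simp

/-- The map `refl_E : E ⟶ Id_B(E)`. -/
def refl : E ⟶ I.idObj F :=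
  ChosenPullbacksAlong.lift (pullback.diagonal p) (F.point ≫ I.reflName) (I.diagonal_idName F)

end PreIdTypeStructure

/-! ## Homotopies -/

section Homotopy

variable {B : C} {X E : Over B} (F : FibrancyStructure π E.hom)

/-- An `Id`-homotopy over `B` from `a` to `b`, where `E` is a `π`-fibrant object over `B`:
a factorisation of `(a, b) : X ⟶ E ×_B E` through the endpoint map of `Id_B(E)`. -/
structure IdHomotopy (a b : X ⟶ E) where
  hom : X.left ⟶ I.idObj F
  hom_endpoints : hom ≫ I.endpoints F =
    pullback.lift a.left b.left ((Over.w a).trans (Over.w b).symm)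

/-- The homotopy `H` from `a` to `b` is constant along `i`: its restriction along `i` is
the reflexivity at the common restriction of `a` and `b`. -/
def IdHomotopy.IsConstantAlong {I : PreIdTypeStructure π} {F : FibrancyStructure π E.hom}
    {a b : X ⟶ E} (H : IdHomotopy I F a b) {W : Over B} (i : W ⟶ X) : Prop :=
  i ≫ a = i ≫ b ∧ i.left ≫ H.hom = (i ≫ a).left ≫ I.refl F

variable {Y : Over B}

/-- `g` is an `Id`-homotopy retraction for `f`: it is a section of `f` and the composite
`E ⟶ Y ⟶ E` is `Id`-homotopic to the identity over `B`. -/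
def IsIdHomotopyRetraction (f : E ⟶ Y) (g : Y ⟶ E) : Prop :=
  g ≫ f = 𝟙 Y ∧ Nonempty (IdHomotopy I F (f ≫ g) (𝟙 E))

/-- `g` exhibits `f` as the dual of a strong `Id`-deformation retract: it is a section of `f` and
the composite `E ⟶ Y ⟶ E` has an `Id`-homotopy to the identity over `B`, constant along `g`. -/
def ExhibitsAsDualStrongDeformationRetract (f : E ⟶ Y) (g : Y ⟶ E) : Prop :=
  g ≫ f = 𝟙 Y ∧ ∃ H : IdHomotopy I F (f ≫ g) (𝟙 E), H.IsConstantAlong g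

end Homotopy

end Id

/-! ## Transport -/

section Transport

variable {T U : C} (π : T ⟶ U) [ChosenPullbacksAlong π] [ExponentiableMorphism π]

/-- The object `π_* (T × U)` over `U`. -/
abbrev genericBase : Over U := (ExponentiableMorphism.pushforward π).obj ((Over.star T).obj U)

/-- The object `π^* π_* (T × U)`. -/
abbrev genericTotal : C := ChosenPullbacksAlong.pullbackObj (genericBase π).hom π

/-- The generic fibration `π^* π_* (T × U) ⟶ π_* (T × U)`. -/
abbrev genericFibration : genericTotal π ⟶ (genericBase π).left :=
  ChosenPullbacksAlong.fst (genericBase π).hom π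

/-- The evaluation `π^* π_* (T × U) ⟶ T × U`, the counit of the adjunction. -/
abbrev genericEv : genericTotal π ⟶ ((Over.star T).obj U).left :=
  ((ExponentiableMorphism.ev π).app ((Over.star T).obj U)).left

/-- The second generic fibration `ev^* (T × T) ⟶ π^* π_* (T × U)`, the pullback of `T × π`
along the evaluation. -/
abbrev genericFibration' :
    pullback (genericEv π) ((Over.star T).map π).left ⟶ genericTotal π :=
  pullback.fst (genericEv π) ((Over.star T).map π).left

variable {π}

/-- A transport structure: a map `ev₀^* ev^* (T × T) ⟶ ev₁^* ev^* (T × T)` over the identity type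
of the generic fibration. -/
structure TransportStructure (I : PreIdTypeStructure π) where
  map :
    pullback (I.ev₀ (FibrancyStructure.canonical π (genericBase π).hom)) (genericFibration' π) ⟶
      pullback (I.ev₁ (FibrancyStructure.canonical π (genericBase π).hom)) (genericFibration' π)
  map_fst : map ≫ pullback.fst _ _ = pullback.fst _ _

end Transport

end

end UniverseCategory

/-! A lifting problem of `X ◁ g` against `B × π` is a type `A` over `X ×_B E` with a section `s` of
`A` restricted along `g`. Given a homotopy `H` from `gf` to `1`, the element `s(x, f e)` lies in
`A(x, g f e)`, and transporting it along `H(e)` gives an element of `A(x, e)`: this is the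
lower-half lift. The fibrancy structure on `E` lets `A` be classified by a map `X ⟶ π_* (T × U)`
(`familyMap`), so that the generic transport applies, and uniformity in `X` is naturality of
transport in generalised elements. If `H` is constant along `g`, the transport over `X ×_B Y` is
along reflexivity, so the upper triangle commutes as soon as transport along reflexivity is the
identity.

Such strict transport comes from `J` and `Π`: the functions `A(e₀) → A(e₁)` form a type over
families and identifications, the identity function inhabits it at reflexivity, and `J` extends this
to all identifications (`refl_jTransport`). `ElementTransport` is the common interface for this
transport and a bare transport structure.

Conversely, lift `g` against the identity type of `(gf, 1)`, starting from reflexivity on `Y`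
(`homotopy_square`). The lower triangle makes the lift a homotopy; the upper one makes it constant
along `g`. -/

namespace UniverseCategory

noncomputable section

attribute [local instance] overCartesian

attribute [local simp] pullback.lift_fst pullback.lift_snd pullback.lift_fst_assoc
  pullback.lift_snd_assoc

/-! ### Maps into `B × V` over `B` -/

section Star

variable {C : Type u} [Category.{v} C] [HasFiniteLimits C] {B : C}

/-- The component in `V` of a map into `B × V` over `B`. -/
def starSnd {X : Over B} {V : C} (a : X ⟶ (Over.star B).obj V) : X.left ⟶ V :=
  ((Over.forgetAdjStar B).homEquiv X V).symm a

/-- The map into `B × V` over `B` with a given component in `V`. -/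
def toStar {X : Over B} {V : C} (a : X.left ⟶ V) : X ⟶ (Over.star B).obj V :=
  (Over.forgetAdjStar B).homEquiv X V a

@[simp]
theorem starSnd_toStar {X : Over B} {V : C} (a : X.left ⟶ V) : starSnd (toStar a) = a :=
  Equiv.symm_apply_apply _ _

theorem starSnd_injective {X : Over B} {V : C} :
    Function.Injective (starSnd : (X ⟶ (Over.star B).obj V) → _) :=
  Equiv.injective _

@[simp]
theorem starSnd_comp {X Y : Over B} {V : C} (t : Y ⟶ X) (a : X ⟶ (Over.star B).obj V) :
    starSnd (t ≫ a) = t.left ≫ starSnd a :=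
  (Over.forgetAdjStar B).homEquiv_naturality_left_symm t a

@[simp]
theorem starSnd_map {X : Over B} {V W : C} (a : X ⟶ (Over.star B).obj V) (f : V ⟶ W) :
    starSnd (a ≫ (Over.star B).map f) = starSnd a ≫ f :=
  (Over.forgetAdjStar B).homEquiv_naturality_right_symm a f

variable (B) in
/-- The projection `B × V ⟶ V`. -/
def starProj (V : C) : ((Over.star B).obj V).left ⟶ V := (Over.forgetAdjStar B).counit.app V

theorem starMap_starProj {V W : C} (f : V ⟶ W) :
    ((Over.star B).map f).left ≫ starProj B W = starProj B V ≫ f :=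
  (Over.forgetAdjStar B).counit.naturality f

theorem starSnd_eq {X : Over B} {V : C} (a : X ⟶ (Over.star B).obj V) :
    starSnd a = a.left ≫ starProj B V :=
  (Over.forgetAdjStar B).homEquiv_counit _ _ a

end Star

/-! ### Generalised elements of chosen pullbacks -/

section ChosenPullback

variable {C : Type u} [Category.{v} C] {T U : C} {π : T ⟶ U} [ChosenPullbacksAlong π] {Γ Δ : C}

theorem comp_lift (σ : Δ ⟶ Γ) {X : C} {n : X ⟶ U} (z : Γ ⟶ X) (t : Γ ⟶ T)
    (h : z ≫ n = t ≫ π) :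
    σ ≫ ChosenPullbacksAlong.lift z t h =
      ChosenPullbacksAlong.lift (σ ≫ z) (σ ≫ t) (by simp [h]) := by
  apply ChosenPullbacksAlong.hom_ext <;> simp

theorem comp_lift_assoc (σ : Δ ⟶ Γ) {X Z : C} {n : X ⟶ U} (z : Γ ⟶ X) (t : Γ ⟶ T)
    (h : z ≫ n = t ≫ π) (k : ChosenPullbacksAlong.pullbackObj n π ⟶ Z) :
    σ ≫ ChosenPullbacksAlong.lift z t h ≫ k =
      ChosenPullbacksAlong.lift (σ ≫ z) (σ ≫ t) (by simp [h]) ≫ k := by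
  rw [← Category.assoc, comp_lift]

theorem lift_pullback_map {X Y : Over U} (k : X ⟶ Y) (z : Γ ⟶ X.left) (t : Γ ⟶ T)
    (h : z ≫ X.hom = t ≫ π) :
    ChosenPullbacksAlong.lift (f := X.hom) z t h ≫
        ((ChosenPullbacksAlong.pullback π).map k).left =
      ChosenPullbacksAlong.lift (f := Y.hom) (z ≫ k.left) t (by simp [h]) := by
  apply ChosenPullbacksAlong.hom_ext
  · have := congr_arg CommaMorphism.left
      ((ChosenPullbacksAlong.mapPullbackAdj π).counit.naturality k)
    simp only [Over.comp_left] at this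
    simp only [ChosenPullbacksAlong.lift_fst, Category.assoc]
    refine (congr_arg (_ ≫ ·) this).trans ?_
    exact ChosenPullbacksAlong.lift_fst_assoc (f := X.hom) z t h k.left
  · simp only [ChosenPullbacksAlong.lift_snd, Category.assoc]
    refine (congr_arg (_ ≫ ·) (Over.w ((ChosenPullbacksAlong.pullback π).map k))).trans ?_
    exact ChosenPullbacksAlong.lift_snd (f := X.hom) z t h

end ChosenPullback

/-! ### Generalised elements of `π_* (T × V)` -/

section Polynomial

variable {C : Type u} [Category.{v} C] [HasFiniteLimits C] {T U : C} (π : T ⟶ U)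
  [ChosenPullbacksAlong π] [ExponentiableMorphism π]

/-- The value `π_* (T × V)` of the polynomial functor of `π`, as an object over `U`. -/
abbrev polyOver (V : C) : Over U := (ExponentiableMorphism.pushforward π).obj ((Over.star T).obj V)

variable {π} {V W Γ Δ : C}

/-- The map to `π_* (T × V)` given by a name `n : Γ ⟶ U` and a map to `V` from the pullback
of `π` along `n`. -/
def polyCurry (n : Γ ⟶ U) (h : ChosenPullbacksAlong.pullbackObj n π ⟶ V) :
    Γ ⟶ (polyOver π V).left :=
  (ExponentiableMorphism.pushforwardCurry (f := π) (A := Over.mk n) (toStar h)).left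

/-- The value at `t : Γ ⟶ T` of the family of elements of `V` given by `z : Γ ⟶ π_* (T × V)`. -/
def polyApp (z : Γ ⟶ (polyOver π V).left) (t : Γ ⟶ T) (h : z ≫ (polyOver π V).hom = t ≫ π) :
    Γ ⟶ V :=
  ChosenPullbacksAlong.lift z t h ≫ starSnd ((ExponentiableMorphism.ev π).app _)

@[simp]
theorem polyCurry_hom (n : Γ ⟶ U) (h : ChosenPullbacksAlong.pullbackObj n π ⟶ V) :
    polyCurry n h ≫ (polyOver π V).hom = n :=
  Over.w (ExponentiableMorphism.pushforwardCurry (f := π) (A := Over.mk n) (toStar h))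

theorem comp_polyApp (σ : Δ ⟶ Γ) (z : Γ ⟶ (polyOver π V).left) (t : Γ ⟶ T)
    (h : z ≫ (polyOver π V).hom = t ≫ π) :
    σ ≫ polyApp z t h = polyApp (σ ≫ z) (σ ≫ t) (by simp [h]) := by
  simp [polyApp, comp_lift_assoc]

/-- The transpose of `k` is its pullback along `π` followed by the counit, and evaluation is defined
by that counit. -/
theorem polyApp_overHom {X : Over U} (k : X ⟶ polyOver π V) (z : Γ ⟶ X.left) (t : Γ ⟶ T)
    (h : z ≫ X.hom = t ≫ π) :
    polyApp (z ≫ k.left) t (by simp [h]) =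
      ChosenPullbacksAlong.lift (f := X.hom) z t h ≫
        starSnd (ExponentiableMorphism.pushforwardUncurry k) := by
  have : ExponentiableMorphism.pushforwardUncurry k =
      (ChosenPullbacksAlong.pullback π).map k ≫ (ExponentiableMorphism.ev π).app _ :=
    (ExponentiableMorphism.pullbackPushforwardAdj π).homEquiv_counit _ _ k
  rw [this, starSnd_comp]
  exact (congr_arg (· ≫ _) (lift_pullback_map k z t h)).symm.trans (Category.assoc _ _ _)

@[simp]
theorem polyApp_comp_polyCurry (σ : Δ ⟶ Γ) (n : Γ ⟶ U)
    (h : ChosenPullbacksAlong.pullbackObj n π ⟶ V) (t : Δ ⟶ T)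
    (w : (σ ≫ polyCurry n h) ≫ (polyOver π V).hom = t ≫ π) :
    polyApp (σ ≫ polyCurry n h) t w =
      ChosenPullbacksAlong.lift σ t (by simpa using w) ≫ h := by
  have := polyApp_overHom (ExponentiableMorphism.pushforwardCurry (f := π) (A := Over.mk n)
    (toStar h)) σ t (by simpa using w)
  rw [ExponentiableMorphism.pushforward_uncurry_curry, starSnd_toStar] at this
  exact this

/-- Transposition is injective, so agreement at the generic element, the projections of the pullback
of `π` along the common name, already suffices. -/
theorem poly_hom_ext {z z' : Γ ⟶ (polyOver π V).left}
    (h : z ≫ (polyOver π V).hom = z' ≫ (polyOver π V).hom)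
    (happ : ∀ {Δ : C} (σ : Δ ⟶ Γ) (t : Δ ⟶ T) (w : (σ ≫ z) ≫ (polyOver π V).hom = t ≫ π)
      (w' : (σ ≫ z') ≫ (polyOver π V).hom = t ≫ π),
      polyApp (σ ≫ z) t w = polyApp (σ ≫ z') t w') : z = z' := by
  let X : Over U := Over.mk (z ≫ (polyOver π V).hom)
  let k : X ⟶ polyOver π V := Over.homMk z rfl
  let k' : X ⟶ polyOver π V := Over.homMk z' h.symm
  suffices k = k' from congr_arg CommaMorphism.left this
  apply ((ExponentiableMorphism.pullbackPushforwardAdj π).homEquiv _ _).symm.injective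
  apply starSnd_injective
  have e : ChosenPullbacksAlong.fst X.hom π ≫ X.hom = ChosenPullbacksAlong.snd X.hom π ≫ π :=
    ChosenPullbacksAlong.condition
  have key := polyApp_overHom k _ _ e
  have key' := polyApp_overHom k' _ _ e
  have hid : ChosenPullbacksAlong.lift (f := X.hom) _ _ e = 𝟙 _ := by
    apply ChosenPullbacksAlong.hom_ext <;> simp
  rw [hid] at key key'
  erw [Category.id_comp] at key key'
  exact key.symm.trans ((happ _ _ _ _).trans key')

/-- The action of the polynomial functor of `π` on maps. -/
def polyMap (f : V ⟶ W) : (polyOver π V).left ⟶ (polyOver π W).left :=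
  ((ExponentiableMorphism.pushforward π).map ((Over.star T).map f)).left

theorem polyApp_map (z : Γ ⟶ (polyOver π V).left) (f : V ⟶ W) (t : Γ ⟶ T)
    (w : z ≫ (polyOver π V).hom = t ≫ π)
    (w' : (z ≫ polyMap f) ≫ (polyOver π W).hom = t ≫ π) :
    polyApp (z ≫ polyMap f) t w' = polyApp z t w ≫ f := by
  have := polyApp_overHom ((ExponentiableMorphism.pushforward π).map ((Over.star T).map f)) z t w
  refine this.trans ?_
  rw [polyApp, Category.assoc, ← starSnd_map]
  congr 2
  exact ((ExponentiableMorphism.pullbackPushforwardAdj π).homEquiv_counit _ _ _).trans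
    (ExponentiableMorphism.ev_naturality π _)

@[simp]
theorem polyMap_hom (f : V ⟶ W) :
    polyMap (π := π) f ≫ (polyOver π W).hom = (polyOver π V).hom :=
  Over.w ((ExponentiableMorphism.pushforward π).map ((Over.star T).map f))

end Polynomial

/-! ### Transport as an operation on generalised elements -/

section ElementTransport

variable {C : Type u} [Category.{v} C] [HasFiniteLimits C] {T U : C} {π : T ⟶ U}
  [ChosenPullbacksAlong π] [ExponentiableMorphism π]

/-- At stage `Γ`: a type with a family of types `z` on it, two elements `e₀` and `e₁` of the type,
an identification `q` between them, and an element `x` of the fibre at `e₀`. -/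
@[ext]
structure TransportInput (I : PreIdTypeStructure π) (Γ : C) where
  z : Γ ⟶ (polyOver π U).left
  e₀ : Γ ⟶ T
  e₁ : Γ ⟶ T
  q : Γ ⟶ T
  x : Γ ⟶ T
  h₀ : z ≫ (polyOver π U).hom = e₀ ≫ π
  h₁ : z ≫ (polyOver π U).hom = e₁ ≫ π
  hq : q ≫ π = pullback.lift e₀ e₁ (h₀.symm.trans h₁) ≫ I.Id
  hx : x ≫ π = polyApp z e₀ h₀

theorem comp_pullback_lift {X Y Z Γ Δ : C} {p : X ⟶ Z} {r : Y ⟶ Z} (σ : Δ ⟶ Γ) (a : Γ ⟶ X)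
    (b : Γ ⟶ Y) (h : a ≫ p = b ≫ r) :
    σ ≫ pullback.lift a b h = pullback.lift (σ ≫ a) (σ ≫ b) (by simp [h]) := by
  apply pullback.hom_ext <;> simp

theorem lift_whiskerLeft_left {B Γ : C} {X K L : Over B} (k : K ⟶ L) (a : Γ ⟶ X.left)
    (b : Γ ⟶ K.left) (h : a ≫ X.hom = b ≫ K.hom) :
    (pullback.lift a b h : Γ ⟶ (X ⊗ K).left) ≫ (X ◁ k).left =
      pullback.lift a (b ≫ k.left) (by simp [h]) := by
  apply pullback.hom_ext <;> simp

/-- Restriction of the input of a transport along a change of stage. -/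
@[simps]
def TransportInput.precomp {I : PreIdTypeStructure π} {Γ Δ : C} (d : TransportInput I Γ)
    (σ : Δ ⟶ Γ) : TransportInput I Δ where
  z := σ ≫ d.z
  e₀ := σ ≫ d.e₀
  e₁ := σ ≫ d.e₁
  q := σ ≫ d.q
  x := σ ≫ d.x
  h₀ := by simp [d.h₀]
  h₁ := by simp [d.h₁]
  hq := by rw [Category.assoc, d.hq, ← Category.assoc, comp_pullback_lift]
  hx := by rw [Category.assoc, d.hx, comp_polyApp]

/-- Transport, as a natural operation on generalised elements. -/
structure ElementTransport (I : PreIdTypeStructure π) where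
  tr : ∀ {Γ : C}, TransportInput I Γ → (Γ ⟶ T)
  tr_π : ∀ {Γ : C} (d : TransportInput I Γ), tr d ≫ π = polyApp d.z d.e₁ d.h₁
  comp_tr : ∀ {Γ Δ : C} (σ : Δ ⟶ Γ) (d : TransportInput I Γ), σ ≫ tr d = tr (d.precomp σ)

/-- Transport along reflexivity is the identity. -/
def ElementTransport.IsStrict {I : PreIdTypeStructure π} (τ : ElementTransport I) : Prop :=
  ∀ {Γ : C} (d : TransportInput I Γ), d.e₀ = d.e₁ → d.q = d.e₀ ≫ I.reflName → τ.tr d = d.x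

namespace TransportInput

variable {I : PreIdTypeStructure π} {Γ Δ : C} (d : TransportInput I Γ)

/-- The element of the generic identity type underlying the input of a transport. -/
def idPoint : Γ ⟶ I.idObj (FibrancyStructure.canonical π (genericBase π).hom) :=
  ChosenPullbacksAlong.lift
    (pullback.lift (ChosenPullbacksAlong.lift d.z d.e₀ d.h₀)
      (ChosenPullbacksAlong.lift d.z d.e₁ d.h₁) (by simp)) d.q (by
    rw [d.hq, PreIdTypeStructure.idName, ← Category.assoc]
    congr 1
    apply pullback.hom_ext <;> simp [FibrancyStructure.canonical])

@[simp]
theorem idPoint_ev₀ : d.idPoint ≫ I.ev₀ _ = ChosenPullbacksAlong.lift d.z d.e₀ d.h₀ := by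
  simp [idPoint, PreIdTypeStructure.ev₀]

@[simp]
theorem idPoint_ev₁ : d.idPoint ≫ I.ev₁ _ = ChosenPullbacksAlong.lift d.z d.e₁ d.h₁ := by
  simp [idPoint, PreIdTypeStructure.ev₁]

theorem comp_idPoint (σ : Δ ⟶ Γ) : σ ≫ d.idPoint = (d.precomp σ).idPoint := by
  simp [idPoint, comp_lift, comp_pullback_lift]

end TransportInput

theorem lift_genericEv_snd {Γ : C} (z : Γ ⟶ (polyOver π U).left) (t : Γ ⟶ T)
    (h : z ≫ (polyOver π U).hom = t ≫ π) :
    (ChosenPullbacksAlong.lift z t h ≫ genericEv π) ≫ starProj T U =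
      polyApp z t h := by
  rw [polyApp, starSnd_eq, Category.assoc]

/-- Both sides are maps over `T` into `T × U`, so only the components in `U` need comparing. The
equation makes `x` a point of the second generic fibration. -/
theorem lift_genericEv_eq {Γ : C} (z : Γ ⟶ (polyOver π U).left) (t x : Γ ⟶ T)
    (h : z ≫ (polyOver π U).hom = t ≫ π) (hx : x ≫ π = polyApp z t h) :
    ChosenPullbacksAlong.lift z t h ≫ genericEv π =
      (toStar (B := T) (X := Over.mk t) x).left ≫ ((Over.star T).map π).left := by
  let k : Over.mk t ⟶ (ChosenPullbacksAlong.pullback π).obj (polyOver π U) :=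
    Over.homMk (ChosenPullbacksAlong.lift z t h) (ChosenPullbacksAlong.lift_snd z t h)
  suffices k ≫ (ExponentiableMorphism.ev π).app _ = toStar x ≫ (Over.star T).map π from
    congr_arg CommaMorphism.left this
  apply starSnd_injective
  rw [starSnd_map, starSnd_toStar, hx, starSnd_comp]
  rfl

namespace TransportInput

variable {I : PreIdTypeStructure π} {Γ Δ : C} (d : TransportInput I Γ)

/-- The element of the domain of a transport structure underlying the input of a transport. -/
def point : Γ ⟶ pullback (I.ev₀ (FibrancyStructure.canonical π (genericBase π).hom))
    (genericFibration' π) :=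
  pullback.lift d.idPoint
    (pullback.lift _ _ (lift_genericEv_eq d.z d.e₀ d.x d.h₀ d.hx)) (by simp)

theorem comp_point (σ : Δ ⟶ Γ) : σ ≫ d.point = (d.precomp σ).point := by
  apply pullback.hom_ext
  · simpa [point] using d.comp_idPoint σ
  · apply pullback.hom_ext
    · simp [point, comp_lift]
    · let s : Over.mk (σ ≫ d.e₀) ⟶ Over.mk d.e₀ := Over.homMk σ
      suffices s ≫ toStar d.x = toStar (X := Over.mk (σ ≫ d.e₀)) (σ ≫ d.x) by
        simpa [point] using! congr_arg CommaMorphism.left this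
      apply starSnd_injective
      simp [s]

end TransportInput

/-- The transport of generalised elements along a transport structure. -/
def TransportStructure.elementTransport {I : PreIdTypeStructure π} (S : TransportStructure I) :
    ElementTransport I where
  tr d := d.point ≫ S.map ≫ pullback.snd _ _ ≫
    pullback.snd (genericEv π) ((Over.star T).map π).left ≫
    starProj T T
  tr_π d := by
    rw [← lift_genericEv_snd d.z d.e₁ d.h₁, ← d.idPoint_ev₁]
    -- The transport map lies over the identity type, so its output sits in the fibre at the right
    -- endpoint of the same identification.
    have h2 : d.point ≫ S.map ≫ pullback.fst _ _ = d.idPoint := by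
      rw [S.map_fst, TransportInput.point, pullback.lift_fst]
    rw [← h2]
    have h3 := pullback.condition_assoc
      (f := I.ev₁ (FibrancyStructure.canonical π (genericBase π).hom)) (g := genericFibration' π)
      (genericEv π ≫ starProj T U)
    simp only [Category.assoc] at h3 ⊢
    rw [h3, ← starMap_starProj, ← pullback.condition_assoc]
  comp_tr σ d := by
    rw [← Category.assoc, d.comp_point]

/-! ### Strict transport from `J`-elimination and function types -/

section Pi

variable (π) in
/-- The object of pairs of a family of types and an identification in its indexing type. -/
abbrev famIdOver (I : PreIdTypeStructure π) : Over U :=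
  polyOver π U ⊗ Over.mk (I.univEndpoints ≫ pullback.fst π π ≫ π)

/-- The name in `π_* (T × U)` of the type of functions between two fibres of a family. -/
def funName {Γ : C} (z : Γ ⟶ (polyOver π U).left) (e₀ e₁ : Γ ⟶ T)
    (h₀ : z ≫ (polyOver π U).hom = e₀ ≫ π) (h₁ : z ≫ (polyOver π U).hom = e₁ ≫ π) :
    Γ ⟶ (polyOver π U).left :=
  polyCurry (polyApp z e₀ h₀)
    (ChosenPullbacksAlong.fst (polyApp z e₀ h₀) π ≫ polyApp z e₁ h₁)

/-- The identity function on a fibre of a family. -/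
def idFun {Γ : C} (z : Γ ⟶ (polyOver π U).left) (e : Γ ⟶ T)
    (h : z ≫ (polyOver π U).hom = e ≫ π) : Γ ⟶ (polyOver π T).left :=
  polyCurry (polyApp z e h) (ChosenPullbacksAlong.snd (polyApp z e h) π)

/-- On elements, both sides are the constant family with value `A(e₁)` over `A(e₀)`. -/
theorem comp_funName {Γ Δ : C} (σ : Δ ⟶ Γ) (z : Γ ⟶ (polyOver π U).left) (e₀ e₁ : Γ ⟶ T)
    (h₀ : z ≫ (polyOver π U).hom = e₀ ≫ π) (h₁ : z ≫ (polyOver π U).hom = e₁ ≫ π) :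
    σ ≫ funName z e₀ e₁ h₀ h₁ =
      funName (σ ≫ z) (σ ≫ e₀) (σ ≫ e₁) (by simp [h₀]) (by simp [h₁]) := by
  apply poly_hom_ext
  · simp [funName, comp_polyApp]
  · intro Θ τ t w w'
    simp only [funName, ← Category.assoc τ σ, polyApp_comp_polyCurry]
    simp [comp_polyApp]

theorem idFun_map {Γ : C} (z : Γ ⟶ (polyOver π U).left) (e : Γ ⟶ T)
    (h : z ≫ (polyOver π U).hom = e ≫ π) :
    idFun z e h ≫ polyMap π = funName z e e h h := by
  apply poly_hom_ext
  · simp [idFun, funName]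
  · intro Θ τ t w w'
    have w₁ : (τ ≫ idFun z e h) ≫ (polyOver π T).hom = t ≫ π := by
      simpa using w
    simp only [← Category.assoc τ (idFun z e h), polyApp_map _ π t w₁]
    simp only [idFun, funName, polyApp_comp_polyCurry]
    simp [ChosenPullbacksAlong.condition]

variable {I : PreIdTypeStructure π}

/-- The element of the object of families and identifications underlying the input of a
transport. -/
def TransportInput.famIdPoint {Γ : C} (d : TransportInput I Γ) : Γ ⟶ (famIdOver π I).left :=
  pullback.lift d.z (ChosenPullbacksAlong.lift (pullback.lift d.e₀ d.e₁ (d.h₀.symm.trans d.h₁))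
    d.q d.hq.symm) (by simp [d.h₀])

theorem TransportInput.comp_famIdPoint {Γ Δ : C} (d : TransportInput I Γ) (σ : Δ ⟶ Γ) :
    σ ≫ d.famIdPoint = (d.precomp σ).famIdPoint := by
  simp [famIdPoint, comp_pullback_lift, comp_lift]

variable (I)

/-- The generic family of types. -/
abbrev famIdFam : (famIdOver π I).left ⟶ (polyOver π U).left := pullback.fst _ _

/-- The left endpoint of the generic identification. -/
abbrev famIdLeft : (famIdOver π I).left ⟶ T :=
  pullback.snd (polyOver π U).hom _ ≫ I.univEndpoints ≫ pullback.fst π π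

/-- The right endpoint of the generic identification. -/
abbrev famIdRight : (famIdOver π I).left ⟶ T :=
  pullback.snd (polyOver π U).hom _ ≫ I.univEndpoints ≫ pullback.snd π π

theorem famIdLeft_w : famIdFam I ≫ (polyOver π U).hom = famIdLeft I ≫ π := by
  simpa using! pullback.condition

theorem famIdRight_w : famIdFam I ≫ (polyOver π U).hom = famIdRight I ≫ π := by
  rw [famIdLeft_w]
  simp [pullback.condition]

variable {I}

@[simp]
theorem TransportInput.famIdPoint_fam {Γ : C} (d : TransportInput I Γ) :
    d.famIdPoint ≫ famIdFam I = d.z :=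
  pullback.lift_fst _ _ _

@[simp]
theorem TransportInput.famIdPoint_left {Γ : C} (d : TransportInput I Γ) :
    d.famIdPoint ≫ famIdLeft I = d.e₀ := by
  refine (pullback.lift_snd_assoc _ _ _ _).trans ?_
  rw [ChosenPullbacksAlong.lift_fst_assoc (h := d.hq.symm), pullback.lift_fst]

@[simp]
theorem TransportInput.famIdPoint_right {Γ : C} (d : TransportInput I Γ) :
    d.famIdPoint ≫ famIdRight I = d.e₁ := by
  refine (pullback.lift_snd_assoc _ _ _ _).trans ?_
  rw [ChosenPullbacksAlong.lift_fst_assoc (h := d.hq.symm), pullback.lift_snd]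

variable (I)

/-- The type of functions between the two fibres of the generic family at the endpoints of the
generic identification. -/
def famIdFun : (famIdOver π I).left ⟶ (polyOver π U).left :=
  funName (famIdFam I) (famIdLeft I) (famIdRight I) (famIdLeft_w I) (famIdRight_w I)

/-- The generic identity function. -/
def famIdFunRefl : (polyOver π U ⊗ Over.mk π).left ⟶ (polyOver π T).left :=
  idFun (pullback.fst (polyOver π U).hom π) (pullback.snd (polyOver π U).hom π) pullback.condition

/-- At reflexivity the two endpoints coincide, so the function type is one of endofunctions. -/
theorem famIdFunRefl_map : famIdFunRefl (π := π) ≫ polyMap π =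
    (polyOver π U ◁ I.univReflOver).left ≫ famIdFun I := by
  rw [famIdFunRefl, idFun_map, famIdFun, comp_funName]
  congr 1
  · simp
  · simp [PreIdTypeStructure.univReflOver, PreIdTypeStructure.univRefl]
  · simp [PreIdTypeStructure.univReflOver, PreIdTypeStructure.univRefl]

variable {I} (J : I.JElimStructure) (P : FibrancyStructure π (polyMap (π := π) π))

/-- The `Π`-type structure `P` names function types in `U`, giving a lifting problem for `J` with
the generic family as parameter. -/
theorem jElim_square : toStar (famIdFunRefl ≫ P.point) ≫ (Over.star U).map π =
    polyOver π U ◁ I.univReflOver ≫ toStar (famIdFun I ≫ P.name) := by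
  apply starSnd_injective
  have h1 : P.point ≫ π = polyMap π ≫ P.name := P.isPullback.w
  have h2 := famIdFunRefl_map I
  rw [starSnd_map, starSnd_toStar, starSnd_comp, starSnd_toStar, Category.assoc, h1,
    ← Category.assoc, h2, Category.assoc]

/-- The transport function along the generic identification, given by `J`-elimination. -/
def jTransport : (famIdOver π I).left ⟶ (polyOver π T).left :=
  P.isPullback.lift (starSnd (J.lift _ _ _ (jElim_square (I := I) P))) (famIdFun I) (by
    rw [← starSnd_map, J.lift_comp, starSnd_toStar])

theorem jTransport_map : jTransport J P ≫ polyMap π = famIdFun I :=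
  P.isPullback.lift_snd _ _ _

theorem refl_jTransport :
    (polyOver π U ◁ I.univReflOver).left ≫ jTransport J P = famIdFunRefl := by
  apply P.isPullback.hom_ext
  · rw [Category.assoc, jTransport, P.isPullback.lift_fst, ← starSnd_comp, J.comp_lift,
      starSnd_toStar]
  · rw [Category.assoc, jTransport, P.isPullback.lift_snd]
    exact (famIdFunRefl_map I).symm

/-- The transport of generalised elements given by `J`-elimination and function types. -/
def jElementTransport : ElementTransport I where
  tr d := polyApp (d.famIdPoint ≫ jTransport J P) d.x (by
    rw [Category.assoc, ← polyMap_hom (π := π) π, ← Category.assoc (jTransport J P),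
      jTransport_map]
    simp [famIdFun, funName, comp_polyApp, d.hx])
  tr_π d := by
    rw [← polyApp_map]
    · simp only [Category.assoc, jTransport_map, famIdFun, funName, polyApp_comp_polyCurry]
      simp [comp_polyApp]
    · rw [Category.assoc, Category.assoc, ← Category.assoc (jTransport J P), jTransport_map]
      simp [famIdFun, funName, comp_polyApp, d.hx]
  comp_tr σ d := by
    rw [comp_polyApp]
    simp [← TransportInput.comp_famIdPoint]

theorem jElementTransport_isStrict : (jElementTransport J P).IsStrict := by
  intro Γ d he hq
  -- The strictness hypotheses say that the point factors through reflexivity, where the transport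
  -- function is the identity function.
  have h : d.famIdPoint = pullback.lift d.z d.e₀ d.h₀ ≫
      (polyOver π U ◁ I.univReflOver).left := by
    refine Eq.trans ?_ (lift_whiskerLeft_left (X := polyOver π U) I.univReflOver d.z d.e₀ d.h₀).symm
    have e : ChosenPullbacksAlong.lift (pullback.lift d.e₀ d.e₁ (d.h₀.symm.trans d.h₁))
        d.q d.hq.symm = d.e₀ ≫ I.univRefl := by
      apply ChosenPullbacksAlong.hom_ext
      · apply pullback.hom_ext <;> simp [PreIdTypeStructure.univRefl, he]
      · simp [PreIdTypeStructure.univRefl, hq]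
    simp only [TransportInput.famIdPoint, e]
    rfl
  simp only [jElementTransport, h, Category.assoc, refl_jTransport, famIdFunRefl, idFun,
    polyApp_comp_polyCurry]
  simp

end Pi

end ElementTransport

/-! ### Homotopies and lifts -/

section Lifts

variable {C : Type u} [Category.{v} C] [HasFiniteLimits C] {T U : C} {π : T ⟶ U}
  [ChosenPullbacksAlong π] {I : PreIdTypeStructure π} {B : C} {E Y : Over B}
  {F : FibrancyStructure π E.hom}

section Family

variable [ExponentiableMorphism π]

variable (F) in
/-- The map to `π_* (T × U)` classifying a family of types over `X ×_B E`. -/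
def familyMap {X : Over B} (A : (X ⊗ E).left ⟶ U) : X.left ⟶ (polyOver π U).left :=
  polyCurry (X.hom ≫ F.name)
    (pullback.lift (f := X.hom) (g := E.hom) (ChosenPullbacksAlong.fst (X.hom ≫ F.name) π)
      (F.isPullback.lift (ChosenPullbacksAlong.snd (X.hom ≫ F.name) π)
        (ChosenPullbacksAlong.fst (X.hom ≫ F.name) π ≫ X.hom) (by
          rw [← ChosenPullbacksAlong.condition, Category.assoc])) (by simp) ≫ A)

theorem familyMap_w {X : Over B} (A : (X ⊗ E).left ⟶ U) {Γ : C} (σ : Γ ⟶ X.left)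
    (ε : Γ ⟶ E.left) (h : σ ≫ X.hom = ε ≫ E.hom) :
    (σ ≫ familyMap F A) ≫ (polyOver π U).hom = (ε ≫ F.point) ≫ π := by
  simp [familyMap, F.isPullback.w, reassoc_of% h]

theorem polyApp_familyMap {X : Over B} (A : (X ⊗ E).left ⟶ U) {Γ : C} (σ : Γ ⟶ X.left)
    (ε : Γ ⟶ E.left) (h : σ ≫ X.hom = ε ≫ E.hom) :
    polyApp (σ ≫ familyMap F A) (ε ≫ F.point) (familyMap_w A σ ε h) =
      pullback.lift σ ε h ≫ A := by
  simp only [familyMap, polyApp_comp_polyCurry]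
  rw [← Category.assoc]
  congr 1
  apply pullback.hom_ext
  · simp
  · apply F.isPullback.hom_ext <;> simp [h]

/-- Needed for uniformity of the lifts in `X`; it is checked on elements of the fibres of `E`. -/
theorem comp_familyMap {X Z : Over B} (t : Z ⟶ X) (A : (X ⊗ E).left ⟶ U) :
    t.left ≫ familyMap F A = familyMap F ((t ▷ E).left ≫ A) := by
  apply poly_hom_ext
  · simp [familyMap]
  · intro Γ σ e w w'
    have he : e ≫ π = (σ ≫ Z.hom) ≫ F.name := by
      simpa [familyMap] using w'.symm
    -- Since `E` is a pullback of `π`, every element of the named type comes from a point of `E`.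
    obtain ⟨ε, rfl, hε⟩ : ∃ ε : Γ ⟶ E.left, ε ≫ F.point = e ∧ ε ≫ E.hom = σ ≫ Z.hom :=
      ⟨F.isPullback.lift e (σ ≫ Z.hom) he, by simp, by simp⟩
    simp only [← Category.assoc σ t.left]
    rw [polyApp_familyMap _ _ _ (by simp [hε]), polyApp_familyMap _ _ _ hε.symm]
    refine Eq.trans ?_ (Category.assoc _ _ _)
    congr 1
    apply pullback.hom_ext <;> simp

/-- The transport problem at a homotopy `f g ~ 1` for a lifting problem of `g` against `π`. -/
def IdHomotopy.transportInput {f : E ⟶ Y} {g : Y ⟶ E}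
    (H : IdHomotopy I F (f ≫ g) (𝟙 E)) {X : Over B} (s : (X ⊗ Y).left ⟶ T)
    (A : (X ⊗ E).left ⟶ U) (h : s ≫ π = (X ◁ g).left ≫ A) :
    TransportInput I (X ⊗ E).left where
  z := pullback.fst X.hom E.hom ≫ familyMap F A
  e₀ := (pullback.snd X.hom E.hom ≫ f.left ≫ g.left) ≫ F.point
  e₁ := pullback.snd X.hom E.hom ≫ F.point
  q := pullback.snd X.hom E.hom ≫ H.hom ≫ ChosenPullbacksAlong.snd _ π
  x := (X ◁ f).left ≫ s
  h₀ := familyMap_w _ _ _ (by simp [pullback.condition])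
  h₁ := familyMap_w _ _ _ pullback.condition
  hq := by
    simp only [Category.assoc]
    rw [← ChosenPullbacksAlong.condition, reassoc_of% H.hom_endpoints,
      PreIdTypeStructure.idName]
    simp only [← Category.assoc]
    congr 1
    apply pullback.hom_ext <;> simp
  hx := by
    rw [polyApp_familyMap _ _ _ (by simp [pullback.condition]), Category.assoc, h,
      ← Category.assoc]
    congr 1
    apply pullback.hom_ext <;> simp

/-- The lower-half lifting structure given by transport along a homotopy `f g ~ 1`. -/
def IdHomotopy.lowerHalfLiftingStructure {f : E ⟶ Y} {g : Y ⟶ E}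
    (H : IdHomotopy I F (f ≫ g) (𝟙 E)) (τ : ElementTransport I) :
    SliceLowerHalfLiftingStructure π g where
  lift X a b h := toStar (τ.tr (H.transportInput (starSnd a) (starSnd b) (by
    rw [← starSnd_map, h, starSnd_comp])))
  lift_comp X a b h := by
    apply starSnd_injective
    rw [starSnd_map, starSnd_toStar, τ.tr_π]
    refine (polyApp_familyMap _ _ _ pullback.condition).trans ?_
    rw [pullback.lift_fst_snd]
    exact Category.id_comp _
  uniform X Z t a b h h' := by
    apply starSnd_injective
    refine (starSnd_toStar _).trans (Eq.trans ?_ (starSnd_comp _ _).symm)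
    rw [starSnd_toStar, τ.comp_tr]
    congr 1
    ext
    · simp [transportInput, ← comp_familyMap]
    · simp [transportInput]
    · simp [transportInput]
    · simp [transportInput]
    · simp only [transportInput, starSnd_comp, TransportInput.precomp_x]
      rw [← Category.assoc, ← Category.assoc, ← Over.comp_left, ← Over.comp_left,
        whisker_exchange]

/-- The full lifting structure given by strict transport along a homotopy `f g ~ 1` which is
constant along `g`. -/
def IdHomotopy.liftingStructure {f : E ⟶ Y} {g : Y ⟶ E} (hg : g ≫ f = 𝟙 Y)
    (H : IdHomotopy I F (f ≫ g) (𝟙 E)) (hH : H.IsConstantAlong g) (τ : ElementTransport I)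
    (hτ : τ.IsStrict) : SliceLiftingStructure π g where
  toLowerHalfLiftingStructure := H.lowerHalfLiftingStructure τ
  comp_lift X a b h := by
    have hg' : g.left ≫ f.left = 𝟙 _ := by rw [← Over.comp_left, hg]; rfl
    have hH' : g.left ≫ H.hom = g.left ≫ I.refl F := by
      rw [hH.2, ← Category.assoc g f g, hg, Category.id_comp]
    apply starSnd_injective
    -- Naturality moves the restriction along `X ◁ g` inside the transport. There the identification
    -- is reflexivity, and strictness returns `s` restricted along `g ≫ f = 𝟙 Y`.
    rw [lowerHalfLiftingStructure, starSnd_comp, starSnd_toStar, τ.comp_tr, hτ]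
    · simp only [transportInput, TransportInput.precomp_x]
      rw [← Category.assoc, ← Over.comp_left, ← whiskerLeft_comp, hg, whiskerLeft_id]
      exact Category.id_comp _
    · simp [transportInput, reassoc_of% hg']
    · simp [transportInput, reassoc_of% hg', reassoc_of% hH', PreIdTypeStructure.refl]

end Family

section Homotopy

/-- The pair of endpoints of a homotopy `f g ~ 1`. -/
def homotopyEndpoints (f : E ⟶ Y) (g : Y ⟶ E) : E.left ⟶ pullback E.hom E.hom :=
  pullback.lift (f ≫ g).left (𝟙 E.left) (by simp)

/-- Along `g` the endpoints `(gf, 1)` become the diagonal, so reflexivity provides the partial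
section. The parameter object is terminal, hence the unitors. -/
theorem homotopy_square {f : E ⟶ Y} {g : Y ⟶ E} (hg : g ≫ f = 𝟙 Y) :
    toStar (X := 𝟙_ (Over B) ⊗ Y)
        ((λ_ Y).hom.left ≫ g.left ≫ F.point ≫ I.reflName) ≫ (Over.star B).map π =
      𝟙_ (Over B) ◁ g ≫ toStar ((λ_ E).hom.left ≫ homotopyEndpoints f g ≫ I.idName F) := by
  have h : g.left ≫ homotopyEndpoints f g = g.left ≫ pullback.diagonal E.hom := by
    have hg' : g.left ≫ f.left = 𝟙 _ := by rw [← Over.comp_left, hg]; rfl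
    apply pullback.hom_ext <;> simp [homotopyEndpoints, reassoc_of% hg']
  apply starSnd_injective
  rw [starSnd_map, starSnd_comp, starSnd_toStar, starSnd_toStar,
    ← Category.assoc (𝟙_ (Over B) ◁ g).left, ← Over.comp_left, leftUnitor_naturality,
    Over.comp_left]
  simp only [Category.assoc, reassoc_of% h, I.diagonal_idName]

/-- The homotopy `f g ~ 1` obtained from lifts of `g` against `π`. -/
def LowerHalfLiftingStructure.idHomotopy {f : E ⟶ Y} {g : Y ⟶ E} (hg : g ≫ f = 𝟙 Y)
    (S : SliceLowerHalfLiftingStructure π g) : IdHomotopy I F (f ≫ g) (𝟙 E) where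
  hom := ChosenPullbacksAlong.lift (homotopyEndpoints f g)
    ((λ_ E).inv.left ≫ starSnd (S.lift _ _ _ (homotopy_square (I := I) (F := F) hg))) (by
      rw [Category.assoc, ← starSnd_map, S.lift_comp, starSnd_toStar, ← Category.assoc,
        ← Over.comp_left, Iso.inv_hom_id]
      exact (Category.id_comp _).symm)
  hom_endpoints := ChosenPullbacksAlong.lift_fst _ _ _

/-- The upper triangle says that the identification restricts along `g` to the reflexivity it was
lifted from. -/
theorem LiftingStructure.idHomotopy_isConstantAlong {f : E ⟶ Y} {g : Y ⟶ E} (hg : g ≫ f = 𝟙 Y)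
    (S : SliceLiftingStructure π g) :
    (S.toLowerHalfLiftingStructure.idHomotopy (I := I) (F := F) hg).IsConstantAlong g := by
  have hc : g ≫ f ≫ g = g := by rw [← Category.assoc, hg, Category.id_comp]
  refine ⟨by rw [hc, Category.comp_id], ?_⟩
  rw [hc]
  apply ChosenPullbacksAlong.hom_ext
  · have hg' : g.left ≫ f.left = 𝟙 _ := by rw [← Over.comp_left, hg]; rfl
    apply pullback.hom_ext <;> simp [LowerHalfLiftingStructure.idHomotopy, homotopyEndpoints,
      PreIdTypeStructure.refl, reassoc_of% hg']
  · simp only [LowerHalfLiftingStructure.idHomotopy, PreIdTypeStructure.refl, Category.assoc,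
      ChosenPullbacksAlong.lift_snd]
    rw [← Category.assoc, ← Over.comp_left, leftUnitor_inv_naturality, Over.comp_left,
      Category.assoc, ← starSnd_comp, S.comp_lift, starSnd_toStar, ← Category.assoc,
      ← Over.comp_left, Iso.inv_hom_id]
    exact Category.id_comp _

end Homotopy

section Characterization

variable [ExponentiableMorphism π] {f : E ⟶ Y} {g : Y ⟶ E}

theorem isIdHomotopyRetraction_iff (hg : g ≫ f = 𝟙 Y) (S : TransportStructure I) :
    IsIdHomotopyRetraction I F f g ↔ Nonempty (SliceLowerHalfLiftingStructure π g) :=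
  ⟨fun ⟨_, ⟨H⟩⟩ ↦ ⟨H.lowerHalfLiftingStructure S.elementTransport⟩,
    fun ⟨L⟩ ↦ ⟨hg, ⟨L.idHomotopy hg⟩⟩⟩

theorem exhibitsAsDualStrongDeformationRetract_iff (hg : g ≫ f = 𝟙 Y)
    (J : I.JElimStructure) (P : PiTypeStructure π) :
    ExhibitsAsDualStrongDeformationRetract I F f g ↔ Nonempty (SliceLiftingStructure π g) := by
  refine ⟨fun ⟨_, H, hH⟩ ↦ ?_, fun ⟨L⟩ ↦ ⟨hg, L.toLowerHalfLiftingStructure.idHomotopy hg,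
    L.idHomotopy_isConstantAlong hg⟩⟩
  -- `polyMap π` unfolds to the action of the polynomial functor on `π`, so the same data serves.
  let P' : FibrancyStructure π (polyMap (π := π) π) := ⟨P.name, P.point, P.isPullback⟩
  exact ⟨H.liftingStructure hg hH (jElementTransport J P') (jElementTransport_isStrict J P')⟩

end Characterization

end Lifts

end

end UniverseCategory

theorem mainTheorem12 {C : Type u} [Category.{v} C] [HasFiniteLimits C]
    {T U : C} (π : T ⟶ U) [ChosenPullbacksAlong π] [ExponentiableMorphism π]
    (I : UniverseCategory.PreIdTypeStructure π)
    {B : C} {E Y : Over B} (F : UniverseCategory.FibrancyStructure π E.hom)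
    (f : E ⟶ Y) (g : Y ⟶ E) (hg : g ≫ f = 𝟙 Y) :
    (Nonempty (UniverseCategory.TransportStructure I) →
      (UniverseCategory.IsIdHomotopyRetraction I F f g ↔
        Nonempty (UniverseCategory.SliceLowerHalfLiftingStructure π g))) ∧
    (Nonempty I.JElimStructure → Nonempty (UniverseCategory.PiTypeStructure π) →
      (UniverseCategory.ExhibitsAsDualStrongDeformationRetract I F f g ↔
        Nonempty (UniverseCategory.SliceLiftingStructure π g))) :=
  ⟨fun ⟨S⟩ ↦ UniverseCategory.isIdHomotopyRetraction_iff hg S,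
    fun ⟨J⟩ ⟨P⟩ ↦ UniverseCategory.exhibitsAsDualStrongDeformationRetract_iff hg J P⟩
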